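/- Let $p>2$ be a prime and let $1\le d\le n\le m$ be integers. Let $G(p^m,p^n,p^d)$ be the group with presentation $\langle a,b,c\mid a^{p^m}=b^{p^n}=c^{p^d}=1,\ b^{-1}ab=ac,\ a^{-1}ca=b^{-1}cb=c\rangle$. A nearring here is a set $R$ with an addition making it a (not necessarily abelian) group $R^+$, an associative multiplication with identity $1$, and the left distributive law $x(y+z)=xy+xz$; it is local if its non-invertible elements form a subgroup of $R^+$, and zero-symmetric if $0\cdot x=0$ for all $x\in R$. Let $R$ be a local nearring with $R^+\cong G(p^m,p^n,p^d)$. Call $(b,c)\in R^2$ admissible if, with $a=1$, we have $ap^m=bp^n=cp^d=0$, $-b+a+b=a+c$, $-a+c+a=-b+c+b=c$ and $R^+=\langle a\rangle+\langle b\rangle+\langle c\rangle$. Then there is an admissible pair $(b,c)$ with $b$ non-invertible, and if $n<m$ then $b$ is non-invertible in every admissible pair. Let $(b,c)$ be any admissible pair and $a=1$. Every $x\in R$ is uniquely of the form $x=ax_1+bx_2+cx_3$ with integers $0\le x_1<p^m$, $0\le x_2<p^n$, $0\le x_3<p^d$, and there are uniquely defined maps $\alpha\colon R\to\mathbb Z_{p^m}$,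 $\beta\colon R\to\mathbb Z_{p^n}$, $\gamma\colon R\to\mathbb Z_{p^d}$ with $xb=a\alpha(x)+b\beta(x)+c\gamma(x)$ for all $x\in R$; below, residues are identified with their least non-negative representatives. For all $x=ax_1+bx_2+cx_3$ and $y=ay_1+by_2+cy_3$ in $R$ with integers $x_j,y_j\ge 0$, $$xy=a\bigl(x_1y_1+y_2\alpha(x)\bigr)+b\bigl(x_2y_1+y_2\beta(x)\bigr)+c\Bigl(-x_1x_2\tbinom{y_1}{2}-\tbinom{y_2}{2}\alpha(x)\beta(x)-x_2y_1y_2\alpha(x)+x_3y_1+y_2\gamma(x)+x_1y_3\beta(x)-x_2y_3\alpha(x)\Bigr),$$ and the following statements hold: (0) $\alpha(0)\equiv 0\pmod{p^m}$, $\beta(0)\equiv 0\pmod{p^n}$ and $\gamma(0)\equiv 0\pmod{p^d}$ if and only if $R$ is zero-symmetric; (1) if $b$ is non-invertible, then $\alpha(x)\equiv 0\pmod p$; (2) if $b$ is non-invertible and $\beta(x)\equiv 0\pmod p$, then $x_1\equiv 0\pmod p$; (3) $\alpha(xy)\equiv x_1\alpha(y)+\alpha(x)\beta(y)\pmod{p^m}$;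 (4) $\beta(xy)\equiv x_2\alpha(y)+\beta(x)\beta(y)\pmod{p^n}$; (5) $\gamma(xy)\equiv -x_1x_2\binom{\alpha(y)}{2}-\alpha(x)\beta(x)\binom{\beta(y)}{2}-x_2\alpha(x)\alpha(y)\beta(y)+x_3\alpha(y)+\gamma(x)\beta(y)+x_1\beta(x)\gamma(y)-x_2\alpha(x)\gamma(y)\pmod{p^d}$. -/

import Mathlib

/-- A (left) nearring with identity: a not necessarily abelian additive group and a
multiplicative monoid, with the left distributive law `x (y + z) = x y + x z`. -/
class Nearring (R : Type*) extends AddGroup R, Monoid R where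
  left_distributive : ∀ x y z : R, x * (y + z) = x * y + x * z

/-- The nearring `R` is zero-symmetric if `0 * x = 0` for all `x`
(the identity `x * 0 = 0` holds in every left nearring). -/
def Nearring.IsZeroSymmetric (R : Type*) [Nearring R] : Prop :=
  ∀ x : R, 0 * x = 0

/-- The nearring `R` is local if its non-invertible elements form a subgroup of the
additive group of `R`. -/
def Nearring.IsLocal (R : Type*) [Nearring R] : Prop :=
  ∃ L : AddSubgroup R, (L : Set R) = {x : R | ¬ IsUnit x}

/-- The relators of the presentation
`⟨a, b, c | a ^ q = b ^ r = c ^ s = 1, b⁻¹ a b = a c, a⁻¹ c a = c, b⁻¹ c b = c⟩`,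
where `a`, `b`, `c` are the free generators with index `0`, `1`, `2`. -/
def relatorsG (q r s : ℕ) : Set (FreeGroup (Fin 3)) :=
  let a : FreeGroup (Fin 3) := FreeGroup.of 0
  let b : FreeGroup (Fin 3) := FreeGroup.of 1
  let c : FreeGroup (Fin 3) := FreeGroup.of 2
  {a ^ q, b ^ r, c ^ s,
    b⁻¹ * a * b * (a * c)⁻¹, a⁻¹ * c * a * c⁻¹, b⁻¹ * c * b * c⁻¹}

/-- The group
`⟨a, b, c | a ^ q = b ^ r = c ^ s = 1, b⁻¹ a b = a c, a⁻¹ c a = c, b⁻¹ c b = c⟩`;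
`GroupG (p ^ m) (p ^ n) (p ^ d)` is the group `G(p^m, p^n, p^d)`. -/
abbrev GroupG (q r s : ℕ) : Type := PresentedGroup (relatorsG q r s)

/-- The elements `a`, `b`, `c` of the additive group `A` satisfy the (additively written)
defining relations of `G(q, r, s)`, and `A = ⟨a⟩ + ⟨b⟩ + ⟨c⟩`. -/
structure IsGeneratingTriple {A : Type*} [AddGroup A] (q r s : ℕ) (a b c : A) : Prop where
  order_a : q • a = 0
  order_b : r • b = 0
  order_c : s • c = 0
  conj_a_b : -b + a + b = a + c
  conj_c_a : -a + c + a = c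
  conj_c_b : -b + c + b = c
  span : ∀ x : A, ∃ k l t : ℤ, x = k • a + l • b + t • c

/-! The relations let every element be written `k a + l b + t c`, with Heisenberg addition. A
concrete Heisenberg group shows that the presented group does not collapse, so `|R| = p^(m+n+d)`. By
counting, coordinates are then unique for every generating triple. Left multiplication by `x` is
additive, hence fixed by `x·1 = x` and `x b`; it sends the commutator `c` to the commutator of `x`
and `x b`. This gives the product formula, and `(xy)b = x(yb)` gives (3)–(5). Statements (1) and (2)
follow because `c`, and `b` when it is non-invertible, lie in the subgroup `L` of non-units.

The hard point is a generator `b` in `L` when `n = m` (`exists_not_isUnit_frattini_ne_zero`).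
Suppose every element outside the Frattini subgroup (the kernel of `φ` onto `(ZMod p)²`) is a unit.
Then a multiplier `h ≠ 1` fixes no such element. So multiplication by `-1` inverts `R/⟨c⟩` and fixes
`c`. The multiplicative commutator `h` of `(1 + c)⁻¹` and `-1` is then trivial on `R/⟨c⟩` and on
`c`, but `h ≠ 1`. It shifts the generators by `s c` and `t c`, and thus fixes `k a + l b` for
coprime `k`, `l` with `ks + lt = 0`, a contradiction. -/

/-! ### Arithmetic of Heisenberg triples -/

/-- The elements `a`, `b`, `c` satisfy the commutation relations of the Heisenberg group:
`c` commutes with `a` and `b`, and it is the commutator of `a` and `b`. -/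
structure IsHeisenbergTriple {A : Type*} [AddGroup A] (a b c : A) : Prop where
  conj_a_b : -b + a + b = a + c
  conj_c_a : -a + c + a = c
  conj_c_b : -b + c + b = c

/-- The element `k a + l b + t c`. -/
def normalForm {A : Type*} [AddGroup A] (a b c : A) (k l t : ℤ) : A := k • a + l • b + t • c

namespace IsHeisenbergTriple

variable {A : Type*} [AddGroup A] {a b c : A}

theorem addCommute_a (h : IsHeisenbergTriple a b c) : AddCommute a c := by
  have := h.conj_c_a
  rw [add_assoc, neg_add_eq_iff_eq_add] at this
  exact this.symm

theorem addCommute_b (h : IsHeisenbergTriple a b c) : AddCommute b c := by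
  have := h.conj_c_b
  rw [add_assoc, neg_add_eq_iff_eq_add] at this
  exact this.symm

theorem add_eq (h : IsHeisenbergTriple a b c) : a + b = b + a + c := by
  have := h.conj_a_b
  rw [add_assoc, neg_add_eq_iff_eq_add] at this
  rw [this, add_assoc]

theorem zsmul_add_zsmul (h : IsHeisenbergTriple a b c) (k l : ℤ) :
    l • b + k • a = k • a + l • b + (-(l * k)) • c := by
  -- Conjugation by `a` carries `b - c` to `b`; taking multiples in `b` and then in `a` produces the
  -- bilinear exponent `-(l k)`.
  have h1 : AddSemiconjBy a (b + (-1 : ℤ) • c) b := by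
    have e : a + b = b + a + c := h.add_eq
    have hc : AddCommute c ((-1 : ℤ) • c) := (AddCommute.refl c).zsmul_right _
    change a + (b + (-1 : ℤ) • c) = b + a
    rw [← add_assoc, e, neg_one_zsmul, add_neg_cancel_right]
  have h2 : AddSemiconjBy a (l • (b + (-1 : ℤ) • c)) (l • b) := h1.zsmul_right l
  have h3 : l • (b + (-1 : ℤ) • c) = l • b + (-l) • c := by
    rw [(h.addCommute_b.zsmul_right (-1)).zsmul_add, smul_smul, mul_neg_one]
  have hla : AddCommute (l • b) ((-l) • c) := (h.addCommute_b.zsmul_left l).zsmul_right _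
  have h4 : AddSemiconjBy (l • b) a (a + (-l) • c) := by
    change l • b + a = a + (-l) • c + l • b
    rw [h3] at h2
    rw [add_assoc, ← hla.eq]
    exact h2.eq.symm
  have h5 := (h4.zsmul_right k).eq
  rw [(h.addCommute_a.zsmul_right (-l)).zsmul_add, smul_smul] at h5
  rw [h5, add_assoc, add_assoc]
  congr 1
  have : k * -l = -(l * k) := by ring
  rw [this]
  exact ((h.addCommute_b.zsmul_left l).zsmul_right _).eq.symm

theorem normalForm_add (h : IsHeisenbergTriple a b c) (k l t k' l' t' : ℤ) :
    normalForm a b c k l t + normalForm a b c k' l' t'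
      = normalForm a b c (k + k') (l + l') (t + t' - l * k') := by
  have ha : ∀ i j : ℤ, i • c + j • a = j • a + i • c := fun i j =>
    ((h.addCommute_a.zsmul_left j).zsmul_right i).eq.symm
  have hb : ∀ i j : ℤ, i • c + j • b = j • b + i • c := fun i j =>
    ((h.addCommute_b.zsmul_left j).zsmul_right i).eq.symm
  unfold normalForm
  calc k • a + l • b + t • c + (k' • a + l' • b + t' • c)
      = k • a + l • b + (t • c + k' • a) + l' • b + t' • c := by simp only [add_assoc]
    _ = k • a + (l • b + k' • a) + (t • c + l' • b) + t' • c := by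
        rw [ha]; simp only [add_assoc]
    _ = k • a + k' • a + l • b + ((-(l * k')) • c + l' • b) + t • c + t' • c := by
        rw [hb, h.zsmul_add_zsmul]; simp only [add_assoc]
    _ = (k + k') • a + (l + l') • b + (t + t' - l * k') • c := by
        rw [hb, add_zsmul, add_zsmul,
          show t + t' - l * k' = -(l * k') + t + t' by ring, add_zsmul, add_zsmul]
        simp only [add_assoc]

theorem normalForm_nsmul (h : IsHeisenbergTriple a b c) (k l t : ℤ) (n : ℕ) :
    n • normalForm a b c k l t
      = normalForm a b c (n * k) (n * l) (n * t - k * l * n.choose 2) := by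
  induction n with
  | zero => simp [normalForm]
  | succ n ih =>
    rw [succ_nsmul, ih, h.normalForm_add, Nat.choose_succ_succ' n 1, Nat.choose_one_right]
    congr 1 <;> push_cast <;> ring

theorem normalForm_neg (h : IsHeisenbergTriple a b c) (k l t : ℤ) :
    -normalForm a b c k l t = normalForm a b c (-k) (-l) (-t - l * k) := by
  rw [neg_eq_iff_add_eq_zero, h.normalForm_add]
  have : t + (-t - l * k) - l * -k = 0 := by ring
  rw [this]
  simp [normalForm]

theorem normalForm_comm (h : IsHeisenbergTriple a b c) (k l t k' l' t' : ℤ) :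
    normalForm a b c k l t + normalForm a b c k' l' t'
      = normalForm a b c k' l' t' + normalForm a b c k l t + (k * l' - l * k') • c := by
  have : (k * l' - l * k') • c = normalForm a b c 0 0 (k * l' - l * k') := by simp [normalForm]
  rw [this]
  simp only [h.normalForm_add]
  congr 1 <;> ring

theorem addCommute_normalForm (h : IsHeisenbergTriple a b c) (k l t u : ℤ) :
    normalForm a b c k l t + u • c = u • c + normalForm a b c k l t := by
  have := h.normalForm_comm k l t 0 0 u
  simpa [normalForm] using this

/-- The subgroup of all elements `k a + l b + t c`. -/
def subgroup (h : IsHeisenbergTriple a b c) : AddSubgroup A where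
  carrier := {x | ∃ k l t : ℤ, x = normalForm a b c k l t}
  zero_mem' := ⟨0, 0, 0, by simp [normalForm]⟩
  add_mem' := by
    rintro _ _ ⟨k, l, t, rfl⟩ ⟨k', l', t', rfl⟩
    exact ⟨_, _, _, h.normalForm_add _ _ _ _ _ _⟩
  neg_mem' := by
    rintro _ ⟨k, l, t, rfl⟩
    exact ⟨_, _, _, h.normalForm_neg _ _ _⟩

theorem a_mem_subgroup (h : IsHeisenbergTriple a b c) : a ∈ h.subgroup :=
  ⟨1, 0, 0, by simp [normalForm]⟩

theorem b_mem_subgroup (h : IsHeisenbergTriple a b c) : b ∈ h.subgroup :=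
  ⟨0, 1, 0, by simp [normalForm]⟩

theorem c_mem_subgroup (h : IsHeisenbergTriple a b c) : c ∈ h.subgroup :=
  ⟨0, 0, 1, by simp [normalForm]⟩

end IsHeisenbergTriple

theorem map_normalForm {A B : Type*} [AddGroup A] [AddGroup B] (f : A →+ B) (a b c : A)
    (k l t : ℤ) : f (normalForm a b c k l t) = normalForm (f a) (f b) (f c) k l t := by
  simp [normalForm]

theorem IsGeneratingTriple.isHeisenbergTriple {A : Type*} [AddGroup A] {q r s : ℕ} {a b c : A}
    (h : IsGeneratingTriple q r s a b c) : IsHeisenbergTriple a b c :=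
  ⟨h.conj_a_b, h.conj_c_a, h.conj_c_b⟩

theorem zsmul_eq_of_nsmul_eq_zero {A : Type*} [AddGroup A] {q : ℕ} {a : A} (h : q • a = 0)
    {k k' : ℤ} (hk : k ≡ k' [ZMOD q]) : k • a = k' • a := by
  obtain ⟨j, hj⟩ := hk.dvd
  have : k' = k + j * q := by linarith
  rw [this, add_zsmul, mul_zsmul, natCast_zsmul, h, zsmul_zero, add_zero]

theorem IsGeneratingTriple.normalForm_congr {A : Type*} [AddGroup A] {q r s : ℕ} {a b c : A}
    (h : IsGeneratingTriple q r s a b c) {k l t k' l' t' : ℤ}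
    (hk : k ≡ k' [ZMOD q]) (hl : l ≡ l' [ZMOD r]) (ht : t ≡ t' [ZMOD s]) :
    normalForm a b c k l t = normalForm a b c k' l' t' := by
  unfold normalForm
  rw [zsmul_eq_of_nsmul_eq_zero h.order_a hk, zsmul_eq_of_nsmul_eq_zero h.order_b hl,
    zsmul_eq_of_nsmul_eq_zero h.order_c ht]

/-! ### A concrete model and uniqueness of coordinates -/

/-- The Heisenberg group with entries modulo `q`, `r` and `s`. -/
@[ext] structure HeisenbergMod (q r s : ℕ) where
  x : ZMod q
  y : ZMod r
  z : ZMod s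

/-- The group law of the Heisenberg group modulo common multiples `q`, `r` of `s`. -/
@[reducible] def HeisenbergMod.addGroup {q r s : ℕ} (hq : s ∣ q) (hr : s ∣ r) :
    AddGroup (HeisenbergMod q r s) :=
  letI : Add (HeisenbergMod q r s) := ⟨fun u v =>
    ⟨u.x + v.x, u.y + v.y,
      u.z + v.z - ZMod.castHom hr (ZMod s) u.y * ZMod.castHom hq (ZMod s) v.x⟩⟩
  letI : Zero (HeisenbergMod q r s) := ⟨⟨0, 0, 0⟩⟩
  letI : Neg (HeisenbergMod q r s) := ⟨fun u =>
    ⟨-u.x, -u.y, -u.z - ZMod.castHom hr (ZMod s) u.y * ZMod.castHom hq (ZMod s) u.x⟩⟩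
  AddGroup.ofLeftAxioms
    (fun u v w => by
      apply HeisenbergMod.ext
      · exact add_assoc _ _ _
      · exact add_assoc _ _ _
      · change (u.z + v.z - ZMod.castHom hr (ZMod s) u.y * ZMod.castHom hq (ZMod s) v.x) + w.z
          - ZMod.castHom hr (ZMod s) (u.y + v.y) * ZMod.castHom hq (ZMod s) w.x
          = u.z + (v.z + w.z - ZMod.castHom hr (ZMod s) v.y * ZMod.castHom hq (ZMod s) w.x)
          - ZMod.castHom hr (ZMod s) u.y * ZMod.castHom hq (ZMod s) (v.x + w.x)
        rw [map_add, map_add]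
        ring)
    (fun u => by
      apply HeisenbergMod.ext
      · exact zero_add _
      · exact zero_add _
      · change 0 + u.z - ZMod.castHom hr (ZMod s) 0 * ZMod.castHom hq (ZMod s) u.x = u.z
        rw [map_zero]
        ring)
    (fun u => by
      apply HeisenbergMod.ext
      · exact neg_add_cancel _
      · exact neg_add_cancel _
      · change -u.z - ZMod.castHom hr (ZMod s) u.y * ZMod.castHom hq (ZMod s) u.x + u.z
          - ZMod.castHom hr (ZMod s) (-u.y) * ZMod.castHom hq (ZMod s) u.x = 0
        rw [map_neg]
        ring)

/-- Here the coordinates of a normal form are visible, so a homomorphism to this group separates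
normal forms. -/
theorem HeisenbergMod.exists_triple {q r s : ℕ} (hq : s ∣ q) (hr : s ∣ r) :
    letI := HeisenbergMod.addGroup hq hr
    ∃ a b c : HeisenbergMod q r s, IsHeisenbergTriple a b c ∧ q • a = 0 ∧ r • b = 0 ∧ s • c = 0 ∧
      ∀ k l t : ℤ, normalForm a b c k l t = ⟨k, l, t⟩ := by
  let _ := HeisenbergMod.addGroup hq hr
  have hadd : ∀ u v : HeisenbergMod q r s, u + v = ⟨u.x + v.x, u.y + v.y,
      u.z + v.z - ZMod.castHom hr (ZMod s) u.y * ZMod.castHom hq (ZMod s) v.x⟩ := fun _ _ => rfl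
  have hneg : ∀ u : HeisenbergMod q r s, -u = ⟨-u.x, -u.y,
      -u.z - ZMod.castHom hr (ZMod s) u.y * ZMod.castHom hq (ZMod s) u.x⟩ := fun _ => rfl
  have hzero : (0 : HeisenbergMod q r s) = ⟨0, 0, 0⟩ := rfl
  have na : ∀ n : ℕ, n • (⟨1, 0, 0⟩ : HeisenbergMod q r s) = ⟨n, 0, 0⟩ := by
    intro n
    induction n with
    | zero => rw [zero_nsmul, hzero]; simp
    | succ n ih => rw [succ_nsmul, ih, hadd]; simp
  have nb : ∀ n : ℕ, n • (⟨0, 1, 0⟩ : HeisenbergMod q r s) = ⟨0, n, 0⟩ := by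
    intro n
    induction n with
    | zero => rw [zero_nsmul, hzero]; simp
    | succ n ih => rw [succ_nsmul, ih, hadd]; simp
  have nc : ∀ n : ℕ, n • (⟨0, 0, 1⟩ : HeisenbergMod q r s) = ⟨0, 0, n⟩ := by
    intro n
    induction n with
    | zero => rw [zero_nsmul, hzero]; simp
    | succ n ih => rw [succ_nsmul, ih, hadd]; simp
  have za : ∀ n : ℤ, n • (⟨1, 0, 0⟩ : HeisenbergMod q r s) = ⟨n, 0, 0⟩ := by
    rintro (n | n)
    · simpa using na n
    · rw [negSucc_zsmul, na, hneg]; simp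
  have zb : ∀ n : ℤ, n • (⟨0, 1, 0⟩ : HeisenbergMod q r s) = ⟨0, n, 0⟩ := by
    rintro (n | n)
    · simpa using nb n
    · rw [negSucc_zsmul, nb, hneg]; simp
  have zc : ∀ n : ℤ, n • (⟨0, 0, 1⟩ : HeisenbergMod q r s) = ⟨0, 0, n⟩ := by
    rintro (n | n)
    · simpa using nc n
    · rw [negSucc_zsmul, nc, hneg]; simp
  refine ⟨⟨1, 0, 0⟩, ⟨0, 1, 0⟩, ⟨0, 0, 1⟩, ⟨?_, ?_, ?_⟩, ?_, ?_, ?_, ?_⟩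
  · simp [hadd, hneg, -ZMod.castHom_apply]
  · simp [hadd, hneg]
  · simp [hadd, hneg]
  · rw [na, hzero]; simp
  · rw [nb, hzero]; simp
  · rw [nc, hzero]; simp
  · intro k l t
    unfold normalForm
    rw [za, zb, zc]
    simp [hadd]

/-- The additive group `A` with the elements `a`, `b`, `c` is a copy of `G(q, r, s)`: there are
homomorphisms out of it for every choice of images that satisfies the defining relations. -/
structure IsStandardTriple {A : Type*} [AddGroup A] (q r s : ℕ) (a b c : A) : Prop
    extends IsGeneratingTriple q r s a b c where
  exists_hom : ∀ (B : Type) [AddGroup B] (a' b' c' : B), IsHeisenbergTriple a' b' c' →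
    q • a' = 0 → r • b' = 0 → s • c' = 0 →
    ∃ f : A →+ B, f a = a' ∧ f b = b' ∧ f c = c'

theorem exists_isStandardTriple {A : Type*} [AddGroup A] {q r s : ℕ}
    (e : Multiplicative A ≃* GroupG q r s) : ∃ a b c : A, IsStandardTriple q r s a b c := by
  let g : Fin 3 → GroupG q r s := fun i => PresentedGroup.of i
  have rel : ∀ w ∈ relatorsG q r s, (PresentedGroup.mk (relatorsG q r s) w) = 1 := fun w hw =>
    PresentedGroup.one_of_mem hw
  let φ : GroupG q r s →* Multiplicative A := e.symm.toMonoidHom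
  have relA : ∀ w ∈ relatorsG q r s, φ (PresentedGroup.mk (relatorsG q r s) w) = 1 :=
    fun w hw => by rw [rel w hw, map_one]
  let u : Fin 3 → A := fun i => (φ (g i)).toAdd
  have r1 := relA (FreeGroup.of 0 ^ q) (by simp [relatorsG])
  have r2 := relA (FreeGroup.of 1 ^ r) (by simp [relatorsG])
  have r3 := relA (FreeGroup.of 2 ^ s) (by simp [relatorsG])
  have r4 := relA ((FreeGroup.of 1)⁻¹ * FreeGroup.of 0 * FreeGroup.of 1
    * (FreeGroup.of 0 * FreeGroup.of 2)⁻¹) (by simp [relatorsG])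
  have r5 := relA ((FreeGroup.of 0)⁻¹ * FreeGroup.of 2 * FreeGroup.of 0
    * (FreeGroup.of 2)⁻¹) (by simp [relatorsG])
  have r6 := relA ((FreeGroup.of 1)⁻¹ * FreeGroup.of 2 * FreeGroup.of 1
    * (FreeGroup.of 2)⁻¹) (by simp [relatorsG])
  simp only [map_mul, map_pow, map_inv] at r1 r2 r3 r4 r5 r6
  have H : IsHeisenbergTriple (u 0) (u 1) (u 2) :=
    ⟨(mul_inv_eq_one (G := Multiplicative A)).1 r4, (mul_inv_eq_one (G := Multiplicative A)).1 r5,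
      (mul_inv_eq_one (G := Multiplicative A)).1 r6⟩
  refine ⟨u 0, u 1, u 2, ⟨r1, r2, r3, H.1, H.2, H.3, ?_⟩, ?_⟩
  · have top : AddSubgroup.toSubgroup H.subgroup = ⊤ := by
      have h1 : (AddSubgroup.toSubgroup H.subgroup).comap φ = ⊤ := by
        rw [eq_top_iff, ← PresentedGroup.closure_range_of, Subgroup.closure_le]
        rintro _ ⟨i, rfl⟩
        have : ∀ i : Fin 3, u i ∈ H.subgroup := by
          intro i
          fin_cases i
          exacts [H.a_mem_subgroup, H.b_mem_subgroup, H.c_mem_subgroup]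
        exact this i
      rw [eq_top_iff]
      intro x _
      obtain ⟨y, rfl⟩ := e.symm.surjective x
      have : y ∈ (AddSubgroup.toSubgroup H.subgroup).comap φ := by rw [h1]; trivial
      exact this
    intro x
    have : Multiplicative.ofAdd x ∈ AddSubgroup.toSubgroup H.subgroup := by rw [top]; trivial
    exact this
  · intro B _ a' b' c' h' ha' hb' hc'
    let f : Fin 3 → Multiplicative B :=
      ![Multiplicative.ofAdd a', Multiplicative.ofAdd b', Multiplicative.ofAdd c']
    have hf : ∀ w ∈ relatorsG q r s, FreeGroup.lift f w = 1 := by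
      intro w hw
      simp only [relatorsG, Set.mem_insert_iff, Set.mem_singleton_iff] at hw
      rcases hw with rfl | rfl | rfl | rfl | rfl | rfl <;>
        simp only [map_mul, map_pow, map_inv, FreeGroup.lift_apply_of, mul_inv_eq_one]
      exacts [ha', hb', hc', h'.conj_a_b, h'.conj_c_a, h'.conj_c_b]
    let F : GroupG q r s →* Multiplicative B := PresentedGroup.toGroup hf
    have key : ∀ i, (F (e (Multiplicative.ofAdd (u i)))) = f i := by
      intro i
      have : e (Multiplicative.ofAdd (u i)) = g i := e.apply_symm_apply (g i)
      rw [this]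
      exact PresentedGroup.toGroup.of hf
    exact ⟨MonoidHom.toAdditive (F.comp e.toMonoidHom), key 0, key 1, key 2⟩

theorem IsStandardTriple.normalForm_inj {A : Type*} [AddGroup A] {q r s : ℕ} {a b c : A}
    (hq : s ∣ q) (hr : s ∣ r) (h : IsStandardTriple q r s a b c) {k l t k' l' t' : ℤ}
    (e : normalForm a b c k l t = normalForm a b c k' l' t') :
    k ≡ k' [ZMOD q] ∧ l ≡ l' [ZMOD r] ∧ t ≡ t' [ZMOD s] := by
  let _ := HeisenbergMod.addGroup hq hr
  obtain ⟨a', b', c', h', ha, hb, hc, hn⟩ := HeisenbergMod.exists_triple hq hr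
  obtain ⟨f, rfl, rfl, rfl⟩ := h.exists_hom _ a' b' c' h' ha hb hc
  have := congrArg f e
  rw [map_normalForm, map_normalForm, hn, hn, HeisenbergMod.mk.injEq] at this
  simpa [ZMod.intCast_eq_intCast_iff] using this

/-- As `c` is the commutator of `a` and `b`, its image is the commutator of their images, a
determinant times `c'`. -/
theorem IsHeisenbergTriple.map_c {A B : Type*} [AddGroup A] [AddGroup B] {a b c : A} {a' b' c' : B}
    (h : IsHeisenbergTriple a b c) (h' : IsHeisenbergTriple a' b' c') (f : A →+ B)
    {k l t k' l' t' : ℤ} (ha : f a = normalForm a' b' c' k l t)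
    (hb : f b = normalForm a' b' c' k' l' t') : f c = (k * l' - l * k') • c' := by
  have e := congrArg f h.add_eq
  simp only [map_add] at e
  rw [ha, hb, h'.normalForm_comm] at e
  exact (add_left_cancel e).symm

theorem IsGeneratingTriple.exists_normalForm {A : Type*} [AddGroup A] {q r s : ℕ} {a b c : A}
    (h : IsGeneratingTriple q r s a b c) (x : A) : ∃ k l t : ℤ, x = normalForm a b c k l t :=
  h.span x

/-- The normal form whose coordinates are the least representatives of residues. -/
def normalFormMod {A : Type*} [AddGroup A] {q r s : ℕ} (a b c : A)
    (u : ZMod q × ZMod r × ZMod s) : A :=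
  normalForm a b c u.1.val u.2.1.val u.2.2.val

theorem val_intCast_modEq (q : ℕ) [NeZero q] (k : ℤ) : ((k : ZMod q).val : ℤ) ≡ k [ZMOD q] := by
  rw [ZMod.val_intCast]
  exact Int.mod_modEq _ _

theorem IsGeneratingTriple.normalFormMod_surjective {A : Type*} [AddGroup A] {q r s : ℕ}
    [NeZero q] [NeZero r] [NeZero s] {a b c : A} (h : IsGeneratingTriple q r s a b c) :
    Function.Surjective (normalFormMod a b c : ZMod q × ZMod r × ZMod s → A) := by
  intro x
  obtain ⟨k, l, t, rfl⟩ := h.exists_normalForm x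
  exact ⟨(k, l, t), h.normalForm_congr (val_intCast_modEq _ _) (val_intCast_modEq _ _)
    (val_intCast_modEq _ _)⟩

theorem IsStandardTriple.card_eq {A : Type*} [AddGroup A] {q r s : ℕ}
    [NeZero q] [NeZero r] [NeZero s] {a b c : A} (hq : s ∣ q) (hr : s ∣ r)
    (h : IsStandardTriple q r s a b c) :
    Nat.card A = Nat.card (ZMod q × ZMod r × ZMod s) := by
  refine (Nat.card_congr (Equiv.ofBijective _ ⟨?_, h.normalFormMod_surjective⟩)).symm
  rintro ⟨k, l, t⟩ ⟨k', l', t'⟩ e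
  obtain ⟨h1, h2, h3⟩ := h.normalForm_inj hq hr e
  simp only [← ZMod.intCast_eq_intCast_iff] at h1 h2 h3
  simp at h1 h2 h3
  simp [h1, h2, h3]

/-- A surjection between finite sets of equal size is injective. Uniqueness of coordinates thus
needs only generation and the order of the group, not the universal property. -/
theorem IsGeneratingTriple.normalFormMod_bijective {A : Type*} [AddGroup A] {q r s : ℕ}
    [NeZero q] [NeZero r] [NeZero s] {a b c : A} (h : IsGeneratingTriple q r s a b c)
    (hA : Nat.card A = Nat.card (ZMod q × ZMod r × ZMod s)) :
    Function.Bijective (normalFormMod a b c : ZMod q × ZMod r × ZMod s → A) :=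
  h.normalFormMod_surjective.bijective_of_nat_card_le hA.ge

theorem IsGeneratingTriple.normalForm_inj {A : Type*} [AddGroup A] {q r s : ℕ}
    [NeZero q] [NeZero r] [NeZero s] {a b c : A} (h : IsGeneratingTriple q r s a b c)
    (hA : Nat.card A = Nat.card (ZMod q × ZMod r × ZMod s)) {k l t k' l' t' : ℤ}
    (e : normalForm a b c k l t = normalForm a b c k' l' t') :
    k ≡ k' [ZMOD q] ∧ l ≡ l' [ZMOD r] ∧ t ≡ t' [ZMOD s] := by
  have : ∀ k l t : ℤ, normalForm a b c k l t
      = normalFormMod a b c ((k : ZMod q), (l : ZMod r), (t : ZMod s)) := fun k l t =>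
    h.normalForm_congr (val_intCast_modEq _ _).symm (val_intCast_modEq _ _).symm
      (val_intCast_modEq _ _).symm
  rw [this, this] at e
  have := (h.normalFormMod_bijective hA).1 e
  simpa [ZMod.intCast_eq_intCast_iff] using this

/-! ### Multiples by odd numbers and change of generators -/

/-- This is where `p > 2` enters: the commutator term in an `N`-fold multiple is itself a multiple
of `N`. -/
theorem odd_choose_two {N : ℕ} (hN : Odd N) : ∃ j, N.choose 2 = N * j := by
  obtain ⟨j, rfl⟩ := hN
  refine ⟨j, ?_⟩
  rw [Nat.choose_two_right, show (2 * j + 1) * (2 * j + 1 - 1) = (2 * j + 1) * j * 2 by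
    rw [Nat.add_sub_cancel]; ring, Nat.mul_div_cancel _ two_pos]

theorem IsHeisenbergTriple.odd_nsmul_normalForm {A : Type*} [AddGroup A] {a b c : A}
    (h : IsHeisenbergTriple a b c) (k l t : ℤ) {N : ℕ} (hN : Odd N) :
    ∃ j : ℤ, N • normalForm a b c k l t = normalForm a b c (N * k) (N * l) (N * j) := by
  obtain ⟨j, hj⟩ := odd_choose_two hN
  refine ⟨t - k * l * j, ?_⟩
  rw [h.normalForm_nsmul, hj]
  congr 1
  push_cast
  ring

theorem IsGeneratingTriple.nsmul_eq_zero_of_odd {A : Type*} [AddGroup A] {q r s : ℕ} {a b c : A}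
    (h : IsGeneratingTriple q r s a b c) {N : ℕ} (hN : Odd N) {k l : ℤ} (hq : (q : ℤ) ∣ N * k)
    (hr : r ∣ N) (hs : s ∣ N) (t : ℤ) : N • normalForm a b c k l t = 0 := by
  obtain ⟨j, hj⟩ := h.isHeisenbergTriple.odd_nsmul_normalForm k l t hN
  rw [hj, h.normalForm_congr (k' := 0) (l' := 0) (t' := 0)]
  · simp [normalForm]
  · exact Int.modEq_zero_iff_dvd.2 hq
  · exact Int.modEq_zero_iff_dvd.2 ((Int.natCast_dvd_natCast.2 hr).mul_right _)
  · exact Int.modEq_zero_iff_dvd.2 ((Int.natCast_dvd_natCast.2 hs).mul_right _)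

/-- A pair of elements that is independent modulo the Frattini subgroup gives a generating
triple. -/
theorem IsGeneratingTriple.of_isCoprime {A : Type*} [AddGroup A] {q r s : ℕ} {a b c : A}
    (h : IsGeneratingTriple q r s a b c) {k l t k' l' t' : ℤ}
    (hq : IsCoprime (k * l' - l * k') q) (hr : IsCoprime (k * l' - l * k') r)
    (hs : IsCoprime (k * l' - l * k') s)
    (hx : q • normalForm a b c k l t = 0) (hy : r • normalForm a b c k' l' t' = 0) :
    IsGeneratingTriple q r s (normalForm a b c k l t) (normalForm a b c k' l' t')
      ((k * l' - l * k') • c) := by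
  have H := h.isHeisenbergTriple
  set D := k * l' - l * k' with hD
  set x := normalForm a b c k l t with hxd
  set y := normalForm a b c k' l' t' with hyd
  have H' : IsHeisenbergTriple x y (D • c) := by
    refine ⟨?_, ?_, ?_⟩
    · rw [add_assoc, neg_add_eq_iff_eq_add, ← add_assoc]
      exact H.normalForm_comm _ _ _ _ _ _
    · rw [add_assoc, neg_add_eq_iff_eq_add]
      exact (H.addCommute_normalForm _ _ _ _).symm
    · rw [add_assoc, neg_add_eq_iff_eq_add]
      exact (H.addCommute_normalForm _ _ _ _).symm
  -- `D` is invertible modulo `N`, so `z` is a multiple of `D • z`.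
  have cancel : ∀ {N : ℕ} {z : A}, N • z = 0 → IsCoprime D N → D • z ∈ H'.subgroup →
      z ∈ H'.subgroup := by
    rintro N z hz ⟨u, v, huv⟩ hm
    have : z = u • (D • z) := by
      rw [smul_smul]
      calc z = (1 : ℤ) • z := (one_zsmul z).symm
        _ = (u * D + v * N) • z := by rw [huv]
        _ = (u * D) • z := by
          rw [add_zsmul, mul_zsmul (n := (N : ℤ)), natCast_zsmul, hz, zsmul_zero, add_zero]
    rw [this]
    exact zsmul_mem hm u
  have hc : c ∈ H'.subgroup := cancel h.order_c hs H'.c_mem_subgroup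
  have hxm := H'.a_mem_subgroup
  have hym := H'.b_mem_subgroup
  have red : ∀ {k l t : ℤ}, normalForm a b c k l t ∈ H'.subgroup →
      k • a + l • b ∈ H'.subgroup := by
    intro k l t hm
    have := sub_mem hm (zsmul_mem hc t)
    simpa [normalForm] using this
  have comb : ∀ i j : ℤ, ∃ u : ℤ, i • (k • a + l • b) + j • (k' • a + l' • b)
      = normalForm a b c (i * k + j * k') (i * l + j * l') u := by
    have nf : ∀ (i k l : ℤ), ∃ u, i • (k • a + l • b) = normalForm a b c (i * k) (i * l) u := by
      intro i k l
      have e : k • a + l • b = normalForm a b c k l 0 := by simp [normalForm]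
      rw [e]
      rcases Int.eq_nat_or_neg i with ⟨N, rfl | rfl⟩
      · exact ⟨_, by rw [natCast_zsmul, H.normalForm_nsmul]⟩
      · rw [neg_zsmul, natCast_zsmul, H.normalForm_nsmul, H.normalForm_neg, neg_mul, neg_mul]
        exact ⟨_, rfl⟩
    intro i j
    obtain ⟨u, hu⟩ := nf i k l
    obtain ⟨v, hv⟩ := nf j k' l'
    rw [hu, hv, H.normalForm_add]
    exact ⟨_, rfl⟩
  have hmem : ∀ i j : ℤ, (i * k + j * k') • a + (i * l + j * l') • b ∈ H'.subgroup := by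
    intro i j
    obtain ⟨u, hu⟩ := comb i j
    refine red (t := u) ?_
    rw [← hu]
    exact add_mem (zsmul_mem (red hxm) i) (zsmul_mem (red hym) j)
  have ha : a ∈ H'.subgroup := by
    refine cancel h.order_a hq ?_
    -- The coefficients here and for `b` below are the rows of the adjugate matrix, which yield `D •
    -- a` and `D • b`.
    have := hmem l' (-l)
    rwa [show l' * k + -l * k' = D by rw [hD]; ring, show l' * l + -l * l' = 0 by ring, zero_zsmul,
      add_zero] at this
  have hb : b ∈ H'.subgroup := by
    refine cancel h.order_b hr ?_
    have := hmem (-k') k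
    rwa [show -k' * l + k * l' = D by rw [hD]; ring, show -k' * k + k * k' = 0 by ring, zero_zsmul,
      zero_add] at this
  refine ⟨hx, hy, ?_, H'.conj_a_b, H'.conj_c_a, H'.conj_c_b, fun z => ?_⟩
  · rw [← natCast_zsmul, smul_smul, mul_comm, ← smul_smul, natCast_zsmul, h.order_c, zsmul_zero]
  · obtain ⟨i, j, u, rfl⟩ := h.exists_normalForm z
    exact add_mem (add_mem (zsmul_mem ha i) (zsmul_mem hb j)) (zsmul_mem hc u)

/-! ### Left multiplications in a nearring and maps to abelian quotients -/

namespace Nearring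

variable {R : Type*} [Nearring R]

/-- Left multiplication by an element of a nearring, as an additive homomorphism. -/
def mulLeft (x : R) : R →+ R := AddMonoidHom.mk' (fun y => x * y) (left_distributive x)

theorem mulLeft_apply (x y : R) : mulLeft x y = x * y := rfl

theorem mul_neg_one (x : R) : x * (-1) = -x := by
  rw [← mulLeft_apply, map_neg, mulLeft_apply, mul_one]

theorem neg_one_mul_neg_one : (-1 : R) * (-1) = 1 := by
  rw [mul_neg_one, neg_neg]

theorem nsmul_eq_zero_of_nsmul_one {N : ℕ} (h : N • (1 : R) = 0) (x : R) : N • x = 0 := by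
  have := map_nsmul (mulLeft x) N 1
  rw [h, map_zero, mulLeft_apply, mul_one] at this
  exact this.symm

theorem nsmul_one_of_isUnit {N : ℕ} {u : R} (hu : IsUnit u) (h : N • u = 0) :
    N • (1 : R) = 0 := by
  obtain ⟨v, rfl⟩ := hu
  have := map_nsmul (mulLeft (↑v⁻¹ : R)) N (v : R)
  rw [h, map_zero, mulLeft_apply, Units.inv_mul] at this
  exact this.symm

theorem eq_one_of_mul_eq {h x : R} (hx : IsUnit x) (e : h * x = x) : h = 1 :=
  hx.mul_right_cancel (by rw [e, one_mul])

end Nearring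

theorem isHeisenbergTriple_zero {B : Type*} [AddCommGroup B] (a b : B) :
    IsHeisenbergTriple a b 0 :=
  ⟨by simp, by simp, by simp⟩

theorem exists_unimodular_mul_add_eq_zero (s t : ℤ) :
    ∃ k l : ℤ, k * s + l * t = 0 ∧ IsCoprime k l := by
  rcases Nat.eq_zero_or_pos (Int.gcd s t) with h | h
  · obtain ⟨rfl, rfl⟩ := Int.gcd_eq_zero_iff.1 h
    exact ⟨1, 0, by ring, isCoprime_one_left⟩
  · obtain ⟨s', t', h1, hs, ht⟩ := Int.exists_gcd_one h
    refine ⟨t', -s', ?_, ((Int.isCoprime_iff_gcd_eq_one.2 h1).symm).neg_right⟩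
    generalize (Int.gcd s t : ℤ) = g at hs ht
    rw [hs, ht]
    ring

theorem IsStandardTriple.exists_hom_zmod {A : Type*} [AddGroup A] {q r s : ℕ} {a b c : A}
    (h : IsStandardTriple q r s a b c) {q' r' : ℕ} (hq : q' ∣ q) (hr : r' ∣ r) :
    ∃ f : A →+ ZMod q' × ZMod r', f c = 0 ∧ ∀ k l t : ℤ,
      f (normalForm a b c k l t) = ((k : ZMod q'), (l : ZMod r')) := by
  have e1 : q • ((1, 0) : ZMod q' × ZMod r') = 0 := by
    ext <;> simp [(ZMod.natCast_eq_zero_iff q q').2 hq]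
  have e2 : r • ((0, 1) : ZMod q' × ZMod r') = 0 := by
    ext <;> simp [(ZMod.natCast_eq_zero_iff r r').2 hr]
  obtain ⟨f, ha, hb, hc⟩ := h.exists_hom (ZMod q' × ZMod r') (1, 0) (0, 1) 0
    (isHeisenbergTriple_zero _ _) e1 e2 (smul_zero _)
  refine ⟨f, hc, fun k l t => ?_⟩
  rw [map_normalForm, ha, hb, hc]
  ext <;> simp [normalForm]

theorem IsGeneratingTriple.exists_map_c {A : Type*} [AddGroup A] {q r s : ℕ} {a b c : A}
    (h : IsGeneratingTriple q r s a b c) (g : A →+ A) : ∃ t : ℤ, g c = t • c := by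
  obtain ⟨k, l, t, e⟩ := h.exists_normalForm (g a)
  obtain ⟨k', l', t', e'⟩ := h.exists_normalForm (g b)
  exact ⟨_, h.isHeisenbergTriple.map_c h.isHeisenbergTriple g e e'⟩

/-! ### Non-units and the Frattini subgroup -/

namespace Nearring

variable {R : Type*} [Nearring R] {p m n d : ℕ} {a b c : R}

theorem pow_nsmul_eq_zero (hp : Odd p) (hdn : d ≤ n) (hnm : n ≤ m)
    (T : IsGeneratingTriple (p ^ m) (p ^ n) (p ^ d) a b c) (x : R) : (p ^ m) • x = 0 := by
  obtain ⟨k, l, t, rfl⟩ := T.exists_normalForm x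
  exact T.nsmul_eq_zero_of_odd hp.pow (dvd_mul_right _ _) (pow_dvd_pow p hnm)
    (pow_dvd_pow p (hdn.trans hnm)) t

theorem pow_nsmul_one_ne_zero (hp : p.Prime) (hdn : d ≤ n) (hnm : n ≤ m)
    (T : IsStandardTriple (p ^ m) (p ^ n) (p ^ d) a b c) {i : ℕ} (hi : i < m) :
    (p ^ i) • (1 : R) ≠ 0 := by
  intro h
  have h0 : normalForm a b c (p ^ i : ℕ) 0 0 = normalForm a b c 0 0 0 := by
    have := nsmul_eq_zero_of_nsmul_one h a
    rw [normalForm, natCast_zsmul, this]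
    simp [normalForm]
  have := (T.normalForm_inj (pow_dvd_pow p (hdn.trans hnm)) (pow_dvd_pow p hdn) h0).1
  have := Int.natCast_dvd_natCast.1 (Int.modEq_zero_iff_dvd.1 this)
  exact absurd ((Nat.pow_dvd_pow_iff_le_right hp.one_lt).1 this) (by omega)

/-- The kernel of the projection onto `(ZMod p) × (ZMod p)` is preserved by endomorphisms. -/
theorem map_frattini_eq_zero (T : IsGeneratingTriple (p ^ m) (p ^ n) (p ^ d) a b c)
    {φ : R →+ ZMod p × ZMod p} (hc : φ c = 0)
    (hφ : ∀ k l t : ℤ, φ (normalForm a b c k l t) = ((k : ZMod p), (l : ZMod p)))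
    (g : R →+ R) {x : R}
    (hx : φ x = 0) : φ (g x) = 0 := by
  obtain ⟨k, l, t, rfl⟩ := T.exists_normalForm x
  rw [hφ, Prod.mk_eq_zero, ZMod.intCast_zmod_eq_zero_iff_dvd,
    ZMod.intCast_zmod_eq_zero_iff_dvd] at hx
  obtain ⟨⟨k, rfl⟩, ⟨l, rfl⟩⟩ := hx
  obtain ⟨u, hu⟩ := IsGeneratingTriple.exists_map_c T g
  have hp : ∀ y : ZMod p × ZMod p, (p : ℤ) • y = 0 := fun y => by
    ext <;> simp
  rw [map_normalForm, normalForm, hu, map_add, map_add, map_zsmul, map_zsmul, map_zsmul,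
    map_zsmul, hc, mul_zsmul, mul_zsmul, hp, hp]
  simp

/-- Endomorphisms preserve the kernel of `φ`, and `x = x·1`; if `φ 1 = 0` then `φ` would vanish
everywhere, although `φ a` and `φ b` do not. -/
theorem frattini_one_ne_zero {L : AddSubgroup R} (hL : ∀ x, x ∈ L ↔ ¬ IsUnit x) (hp : p.Prime)
    (T : IsGeneratingTriple (p ^ m) (p ^ n) (p ^ d) a b c)
    {φ : R →+ ZMod p × ZMod p} (hc : φ c = 0)
    (hφ : ∀ k l t : ℤ, φ (normalForm a b c k l t) = ((k : ZMod p), (l : ZMod p))) : φ 1 ≠ 0 := by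
  have := Fact.mk hp
  intro h
  have hu : ∀ x, φ x ≠ 0 → x ∈ L := by
    intro x hx
    rw [hL]
    intro _
    apply hx
    have := map_frattini_eq_zero T hc hφ (mulLeft x) h
    rwa [mulLeft_apply, mul_one] at this
  have ha : a ∈ L := hu a (by
    have := hφ 1 0 0
    simp only [normalForm, one_zsmul, zero_zsmul, add_zero] at this
    simp [this])
  have hb : b ∈ L := hu b (by
    have := hφ 0 1 0
    simp only [normalForm, one_zsmul, zero_zsmul, add_zero, zero_add] at this
    simp [this])
  have hcL : c ∈ L := by
    have : c = -(b + a) + (a + b) := by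
      rw [T.isHeisenbergTriple.add_eq, neg_add_cancel_left]
    rw [this]
    exact add_mem (neg_mem (add_mem hb ha)) (add_mem ha hb)
  refine (hL 1).1 ?_ isUnit_one
  obtain ⟨k, l, t, e⟩ := T.exists_normalForm 1
  rw [e]
  exact add_mem (add_mem (zsmul_mem ha k) (zsmul_mem hb l)) (zsmul_mem hcL t)

/-- The kernel of `φ` is generated by `c` and `p`-fold multiples. If `c` were a unit, `1 = c⁻¹c`
would be a multiple of `c`; if `p y` were a unit, `p^(m-1)` would annihilate `1`. -/
theorem mem_nonunits_of_frattini_eq_zero {L : AddSubgroup R} (hL : ∀ x, x ∈ L ↔ ¬ IsUnit x)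
    (hp : p.Prime) (hp2 : Odd p) (hd : 1 ≤ d) (hdn : d ≤ n) (hnm : n ≤ m)
    (T : IsStandardTriple (p ^ m) (p ^ n) (p ^ d) a b c)
    {φ : R →+ ZMod p × ZMod p} (hc : φ c = 0)
    (hφ : ∀ k l t : ℤ, φ (normalForm a b c k l t) = ((k : ZMod p), (l : ZMod p)))
    {x : R} (hx : φ x = 0) : x ∈ L := by
  have T' := T.toIsGeneratingTriple
  have hcL : c ∈ L := by
    rw [hL]
    rintro ⟨v, hv⟩
    obtain ⟨t, ht⟩ := IsGeneratingTriple.exists_map_c T' (mulLeft (↑v⁻¹ : R))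
    rw [mulLeft_apply, ← hv, Units.inv_mul, hv] at ht
    apply frattini_one_ne_zero hL hp T' hc hφ
    rw [ht, map_zsmul, hc, zsmul_zero]
  have hpL : ∀ y : R, p • y ∈ L := by
    intro y
    rw [hL]
    intro hy
    refine pow_nsmul_one_ne_zero hp hdn hnm T (i := m - 1) (by omega)
      (nsmul_one_of_isUnit hy ?_)
    rw [smul_smul, ← pow_succ, Nat.sub_add_cancel (by omega)]
    exact pow_nsmul_eq_zero hp2 hdn hnm T' y
  obtain ⟨k, l, t, rfl⟩ := T.exists_normalForm x
  rw [hφ, Prod.mk_eq_zero, ZMod.intCast_zmod_eq_zero_iff_dvd,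
    ZMod.intCast_zmod_eq_zero_iff_dvd] at hx
  obtain ⟨⟨k, rfl⟩, ⟨l, rfl⟩⟩ := hx
  refine add_mem (add_mem ?_ ?_) (zsmul_mem hcL t)
  · rw [mul_comm, mul_zsmul, natCast_zsmul]; exact zsmul_mem (hpL a) k
  · rw [mul_comm, mul_zsmul, natCast_zsmul]; exact zsmul_mem (hpL b) l

/-- There is a non-invertible element outside of the Frattini subgroup. -/
theorem exists_not_isUnit_frattini_ne_zero {L : AddSubgroup R} (hL : ∀ x, x ∈ L ↔ ¬ IsUnit x)
    (hp : p.Prime) (hp2 : Odd p) (hd : 1 ≤ d) (hdn : d ≤ n) (hnm : n ≤ m)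
    (T : IsStandardTriple (p ^ m) (p ^ n) (p ^ d) a b c)
    {φ : R →+ ZMod p × ZMod p} (hc : φ c = 0)
    (hφ : ∀ k l t : ℤ, φ (normalForm a b c k l t) = ((k : ZMod p), (l : ZMod p))) :
    ∃ x ∈ L, φ x ≠ 0 := by
  by_contra hcon
  have unit : ∀ x, φ x ≠ 0 → IsUnit x := by
    intro x hx
    by_contra h
    exact hcon ⟨x, (hL x).2 h, hx⟩
  have T' := T.toIsGeneratingTriple
  have H := T'.isHeisenbergTriple
  have h1 : φ 1 ≠ 0 := frattini_one_ne_zero hL hp T' hc hφ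
  have exp := pow_nsmul_eq_zero hp2 hdn hnm T'
  obtain ⟨J, hJ⟩ := hp2.pow (n := m)
  obtain ⟨π, hπc, hπ⟩ := T.exists_hom_zmod (dvd_refl (p ^ m)) (dvd_refl (p ^ n))
  -- Since `p^m = 2J + 1`, multiplication by `J + 1` halves elements.
  have Jtwo : ∀ x : ZMod (p ^ m) × ZMod (p ^ n), (J + 1) • (2 • x) = x := by
    intro x
    have hx : (p ^ m) • x = 0 := by
      ext
      · simp [show ((p : ZMod (p ^ m)) ^ m) = 0 by
          rw [← Nat.cast_pow, ZMod.natCast_eq_zero_iff]]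
      · simp [show ((p : ZMod (p ^ n)) ^ m) = 0 by
          rw [← Nat.cast_pow, ZMod.natCast_eq_zero_iff]; exact pow_dvd_pow p hnm]
    rw [smul_smul, show (J + 1) * 2 = p ^ m + 1 by rw [hJ]; ring, succ_nsmul, hx, zero_add]
  -- elements with the same image under `π` differ by a multiple of `c`
  have ker : ∀ {x y : R}, π x = π y → ∃ t : ℤ, x = y + t • c := by
    intro x y e
    have hxy : π (-y + x) = 0 := by rw [map_add, map_neg, e, neg_add_cancel]
    obtain ⟨k, l, t, h⟩ := T.exists_normalForm (-y + x)
    rw [h, hπ, Prod.mk_eq_zero, ZMod.intCast_zmod_eq_zero_iff_dvd,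
      ZMod.intCast_zmod_eq_zero_iff_dvd] at hxy
    refine ⟨t, ?_⟩
    rw [← neg_add_eq_iff_eq_add, h, T'.normalForm_congr (Int.modEq_zero_iff_dvd.2 hxy.1)
      (Int.modEq_zero_iff_dvd.2 hxy.2) (Int.ModEq.refl t)]
    simp [normalForm]
  -- Left multiplications descend to the abelian quotient `R/⟨c⟩`.
  have resp : ∀ (g : R) {x y : R}, π x = π y → π (g * x) = π (g * y) := by
    intro g x y e
    obtain ⟨t, rfl⟩ := ker e
    obtain ⟨u, hu⟩ := IsGeneratingTriple.exists_map_c T' (mulLeft g)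
    rw [left_distributive, ← mulLeft_apply g (t • c), map_zsmul, hu, map_add, map_zsmul,
      map_zsmul, hπc]
    simp
  set ζ : R →+ R := mulLeft (-1) with hζ
  have ζζ : ∀ x, ζ (ζ x) = x := by
    intro x
    simp only [hζ, mulLeft_apply]
    rw [← mul_assoc, neg_one_mul_neg_one, one_mul]
  have two_ne : ∀ x : R, x + x = 0 → x = 0 := by
    intro x hx
    have h := exp x
    rwa [hJ, succ_nsmul, mul_nsmul, two_nsmul, hx, nsmul_zero, zero_add] at h
  have neg_one_ne : (-1 : R) ≠ 1 := by
    intro h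
    apply h1
    rw [two_ne 1 (neg_eq_iff_add_eq_zero.1 h), map_zero]
  -- `-1` inverts everything modulo the Frattini subgroup
  have step1 : ∀ x, φ (x + ζ x) = 0 := by
    intro x
    by_contra hw
    set w := x + ζ x with hwd
    have hwζ : π (ζ w) = π w := by
      rw [hwd, map_add ζ, ζζ, map_add, map_add, add_comm]
    obtain ⟨t, ht⟩ := ker hwζ
    have htc : t • ζ c = -(t • c) := by
      have := ζζ w
      rw [ht, map_add, ht, map_zsmul, add_assoc, add_eq_left] at this
      exact (neg_eq_of_add_eq_zero_right this).symm
    -- `s` is half of `t`: since `ζ` sends `t c` to `-t c`, the correction `s c` turns `w` into a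
    -- true fixed point.
    set s : ℤ := (J + 1 : ℕ) * t with hs
    have hfix : ζ (w + s • c) = w + s • c := by
      rw [map_add, map_zsmul, ht, hs, mul_zsmul, mul_zsmul, htc, add_assoc]
      congr 1
      have : t • c = ((J + 1 : ℕ) : ℤ) • (t • c) + ((J + 1 : ℕ) : ℤ) • (t • c) := by
        rw [← add_zsmul, show ((J + 1 : ℕ) : ℤ) + ((J + 1 : ℕ) : ℤ) = ((p ^ m : ℕ) : ℤ) + 1 by
          rw [hJ]; push_cast; ring, add_zsmul, natCast_zsmul, exp, zero_add, one_zsmul]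
      rw [zsmul_neg]
      nth_rewrite 1 [this]
      rw [add_neg_cancel_right]
    refine neg_one_ne (eq_one_of_mul_eq (unit (w + s • c) ?_) hfix)
    rwa [map_add, map_zsmul, hc, zsmul_zero, add_zero]
  have divp : ∀ x, φ x = 0 → ∃ y, π x = p • π y := by
    intro x hx
    obtain ⟨k, l, t, rfl⟩ := T.exists_normalForm x
    rw [hφ, Prod.mk_eq_zero, ZMod.intCast_zmod_eq_zero_iff_dvd,
      ZMod.intCast_zmod_eq_zero_iff_dvd] at hx
    obtain ⟨⟨k, rfl⟩, ⟨l, rfl⟩⟩ := hx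
    refine ⟨normalForm a b c k l 0, ?_⟩
    rw [hπ, hπ]
    ext <;> simp
  have step2 : ∀ x, π (ζ x) = -π x := by
    intro x
    have fixed : π (ζ (x + ζ x)) = π (x + ζ x) := by
      rw [map_add ζ, ζζ, map_add, map_add, add_comm]
    -- As `x + ζ x` is fixed modulo `c`, applying `id + ζ` to it only doubles it, while `step1`
    -- makes each application gain a factor `p`. At `i = m` everything vanishes.
    have : ∀ i : ℕ, ∃ v, π (x + ζ x) = π ((p ^ i) • v) := by
      intro i
      induction i with
      | zero => exact ⟨x + ζ x, by simp⟩
      | succ i ih =>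
        obtain ⟨v, hv⟩ := ih
        obtain ⟨y, hy⟩ := divp _ (step1 v)
        have e : 2 • π (x + ζ x) = (p ^ (i + 1)) • π y := by
          have := resp (-1) hv
          rw [two_nsmul]
          nth_rewrite 1 [← fixed]
          change π (ζ (x + ζ x)) = π (ζ _) at this
          rw [this, hv, map_nsmul, map_nsmul, map_nsmul, ← nsmul_add, add_comm, ← map_add, hy,
            smul_smul, pow_succ]
        refine ⟨(J + 1) • y, ?_⟩
        rw [← Jtwo (π (x + ζ x)), e, map_nsmul, map_nsmul, smul_smul, smul_smul, mul_comm]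
    obtain ⟨v, hv⟩ := this m
    rw [exp, map_zero, map_add] at hv
    exact (neg_eq_of_add_eq_zero_right hv).symm
  have ζnf : ∀ x : R, ∃ t : ℤ, ζ x = -x + t • c := fun x =>
    ker (by rw [step2, map_neg])
  have ζc : ζ c = c := by
    obtain ⟨s, hs⟩ := ζnf a
    obtain ⟨t, ht⟩ := ζnf b
    have ea : ζ a = normalForm a b c (-1) 0 s := by simp [normalForm, hs]
    have eb : ζ b = normalForm a b c 0 (-1) t := by simp [normalForm, ht]
    rw [H.map_c H ζ ea eb]
    simp
  have c_ne : c ≠ 0 := by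
    intro h
    have e : normalForm a b c 0 0 1 = normalForm a b c 0 0 0 := by simp [normalForm, h]
    have := (T.normalForm_inj (pow_dvd_pow p (hdn.trans hnm)) (pow_dvd_pow p hdn) e).2.2
    have := Int.modEq_zero_iff_dvd.1 this
    have := Int.natCast_dvd_natCast.1 (by simpa using this : ((p ^ d : ℕ) : ℤ) ∣ ((1 : ℕ) : ℤ))
    exact absurd (Nat.dvd_one.1 this) (Nat.one_lt_pow (by omega) hp.one_lt).ne'
  have one_c : (1 : R) + c = c + 1 := by
    obtain ⟨k, l, t, e⟩ := T.exists_normalForm (1 : R)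
    have := H.addCommute_normalForm k l t 1
    rwa [← e, one_zsmul] at this
  obtain ⟨κ, hκ⟩ : IsUnit ((1 : R) + c) := unit _ (by rwa [map_add, hc, add_zero])
  -- If `h` were `1`, then `(-1)κ(-1) = κ`; but the left side is `1 - c`, which forces `2c = 0`.
  set h : R := ↑κ⁻¹ * ((-1) * (κ * (-1))) with hh
  have h_ne : h ≠ 1 := by
    intro e
    have e2 : (-1 : R) * (κ * (-1)) = κ := by
      have := congrArg (fun y => (κ : R) * y) e
      simpa [hh] using this
    rw [mul_neg_one, hκ] at e2
    have e3 : (-1 : R) * (-(1 + c)) = -(-1 + c) := by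
      rw [← mulLeft_apply, map_neg, map_add, mulLeft_apply, mul_one]
      change -(-1 + ζ c) = _
      rw [ζc]
    rw [e3, neg_add_rev, neg_neg, one_c, add_left_inj] at e2
    refine c_ne (two_ne c ?_)
    nth_rewrite 1 [← e2]
    exact neg_add_cancel c
  have hπh : ∀ x, π (h * x) = π x := by
    intro x
    have e1 : π (κ * ((-1) * x)) = π (κ * (-x)) :=
      resp _ (by rw [map_neg]; exact step2 x)
    have e2 : π ((-1) * (κ * ((-1) * x))) = π (κ * x) := by
      have := step2 (κ * ((-1) * x))
      change π ((-1) * (κ * ((-1) * x))) = _ at this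
      rw [this, e1, ← mulLeft_apply, map_neg, map_neg, neg_neg, mulLeft_apply]
    have e3 := resp (↑κ⁻¹) e2
    rw [Units.inv_mul_cancel_left] at e3
    rw [hh, ← e3]
    simp only [mul_assoc]
  obtain ⟨s, hs⟩ := ker (hπh a)
  obtain ⟨t, ht⟩ := ker (hπh b)
  have hhc : h * c = c := by
    have ea : mulLeft h a = normalForm a b c 1 0 s := by simp [normalForm, mulLeft_apply, hs]
    have eb : mulLeft h b = normalForm a b c 0 1 t := by simp [normalForm, mulLeft_apply, ht]
    rw [← mulLeft_apply, H.map_c H (mulLeft h) ea eb]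
    simp
  obtain ⟨k, l, hkl, hcop⟩ := exists_unimodular_mul_add_eq_zero s t
  have hfix : h * normalForm a b c k l 0 = normalForm a b c k l 0 := by
    have ca : AddCommute a (s • c) := H.addCommute_a.zsmul_right s
    have cb : AddCommute b (t • c) := H.addCommute_b.zsmul_right t
    have cb' : AddCommute (l • b) ((k * s) • c) :=
      (H.addCommute_b.zsmul_left l).zsmul_right _
    rw [← mulLeft_apply, map_normalForm, mulLeft_apply, mulLeft_apply, mulLeft_apply, hhc, hs, ht,
      normalForm, ca.zsmul_add, cb.zsmul_add, smul_smul, smul_smul, add_assoc (k • a),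
      ← add_assoc ((k * s) • c), ← cb'.eq, add_assoc (l • b), ← add_zsmul, hkl]
    simp [normalForm]
  -- Coprime `k`, `l` are not both divisible by `p`, so the fixed element is outside the Frattini
  -- subgroup.
  refine h_ne (eq_one_of_mul_eq (unit _ ?_) hfix)
  rw [hφ, Ne, Prod.mk_eq_zero, ZMod.intCast_zmod_eq_zero_iff_dvd,
    ZMod.intCast_zmod_eq_zero_iff_dvd]
  rintro ⟨hk, hl⟩
  have := hcop.isUnit_of_dvd' hk hl
  exact hp.one_lt.ne' (by simpa [Int.isUnit_iff_natAbs_eq] using this)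

end Nearring

/-! ### Coordinates by least residues -/

theorem normalForm_natCast {A : Type*} [AddGroup A] (a b c : A) (k l t : ℕ) :
    normalForm a b c k l t = k • a + l • b + t • c := by
  simp [normalForm]

theorem normalFormMod_eq {A : Type*} [AddGroup A] {q r s : ℕ} (a b c : A)
    (u : ZMod q × ZMod r × ZMod s) :
    normalFormMod a b c u = u.1.val • a + u.2.1.val • b + u.2.2.val • c :=
  normalForm_natCast _ _ _ _ _ _

theorem IsGeneratingTriple.existsUnique_coordinates {A : Type*} [AddGroup A] {q r s : ℕ}
    [NeZero q] [NeZero r] [NeZero s] {a b c : A} (h : IsGeneratingTriple q r s a b c)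
    (hA : Nat.card A = Nat.card (ZMod q × ZMod r × ZMod s)) (x : A) :
    ∃! u : ℕ × ℕ × ℕ, u.1 < q ∧ u.2.1 < r ∧ u.2.2 < s ∧
      x = u.1 • a + u.2.1 • b + u.2.2 • c := by
  obtain ⟨u, rfl⟩ := h.normalFormMod_surjective x
  refine ⟨(u.1.val, u.2.1.val, u.2.2.val),
    ⟨ZMod.val_lt _, ZMod.val_lt _, ZMod.val_lt _, normalFormMod_eq _ _ _ _⟩, ?_⟩
  rintro ⟨k, l, t⟩ ⟨hk, hl, ht, e⟩
  rw [← normalForm_natCast] at e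
  obtain ⟨h1, h2, h3⟩ := h.normalForm_inj hA e
  simp only [Int.natCast_modEq_iff] at h1 h2 h3
  ext
  · exact (h1.eq_of_lt_of_lt (ZMod.val_lt _) hk).symm
  · exact (h2.eq_of_lt_of_lt (ZMod.val_lt _) hl).symm
  · exact (h3.eq_of_lt_of_lt (ZMod.val_lt _) ht).symm

theorem IsGeneratingTriple.existsUnique_map {A : Type*} [AddGroup A] {q r s : ℕ}
    [NeZero q] [NeZero r] [NeZero s] {a b c : A} (h : IsGeneratingTriple q r s a b c)
    (hA : Nat.card A = Nat.card (ZMod q × ZMod r × ZMod s)) {X : Type*} (g : X → A) :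
    ∃! f : X → ZMod q × ZMod r × ZMod s, ∀ x,
      g x = (f x).1.val • a + (f x).2.1.val • b + (f x).2.2.val • c := by
  simp only [← normalFormMod_eq]
  let e := Equiv.ofBijective _ (h.normalFormMod_bijective hA)
  refine ⟨fun x => e.symm (g x), fun x => (e.apply_symm_apply (g x)).symm, fun f hf => ?_⟩
  funext x
  exact (e.symm_apply_eq.2 (hf x)).symm

/-! ### The product formula and generators containing the identity -/

namespace Nearring

variable {R : Type*} [Nearring R] {p m n d : ℕ} {b c : R}

/-- Left distributivity expands the product into multiples of `x`, `x b` and `x c`, where `x c` is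
the commutator of the first two; the binomials come from multiples of normal forms. -/
theorem mul_normalForm (H : IsHeisenbergTriple 1 b c) {x : R} {x₁ x₂ x₃ k l t : ℤ}
    (hx : x = normalForm 1 b c x₁ x₂ x₃) (hxb : x * b = normalForm 1 b c k l t)
    (y₁ y₂ y₃ : ℕ) :
    x * normalForm 1 b c y₁ y₂ y₃ = normalForm 1 b c (x₁ * y₁ + y₂ * k) (x₂ * y₁ + y₂ * l)
      (-(x₁ * x₂ * y₁.choose 2) - y₂.choose 2 * k * l - x₂ * y₁ * y₂ * k + x₃ * y₁ + y₂ * t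
        + x₁ * y₃ * l - x₂ * y₃ * k) := by
  have hxc : x * c = (x₁ * l - x₂ * k) • c :=
    H.map_c H (mulLeft x) ((mul_one x).trans hx) hxb
  have hc : (y₃ : ℤ) • ((x₁ * l - x₂ * k) • c)
      = normalForm 1 b c 0 0 (y₃ * (x₁ * l - x₂ * k)) := by
    simp [normalForm, mul_smul]
  rw [← mulLeft_apply, map_normalForm, mulLeft_apply, mulLeft_apply, mulLeft_apply, mul_one, hxb,
    hxc, normalForm.eq_def x, hc, hx, natCast_zsmul, natCast_zsmul, H.normalForm_nsmul,
    H.normalForm_nsmul, H.normalForm_add, H.normalForm_add]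
  congr 1 <;> ring

theorem mul_mul_normalForm (H : IsHeisenbergTriple 1 b c) {x y : R} {x₁ x₂ x₃ k l t : ℤ}
    {y₁ y₂ y₃ : ℕ} (hx : x = normalForm 1 b c x₁ x₂ x₃) (hxb : x * b = normalForm 1 b c k l t)
    (hyb : y * b = normalForm 1 b c y₁ y₂ y₃) :
    x * y * b = normalForm 1 b c (x₁ * y₁ + y₂ * k) (x₂ * y₁ + y₂ * l)
      (-(x₁ * x₂ * y₁.choose 2) - y₂.choose 2 * k * l - x₂ * y₁ * y₂ * k + x₃ * y₁ + y₂ * t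
        + x₁ * y₃ * l - x₂ * y₃ * k) := by
  rw [mul_assoc, hyb, mul_normalForm H hx hxb]

/-- Otherwise `k` is invertible modulo `p^m`, so `1` is a multiple of `k • 1` and lies in `L`. -/
theorem dvd_of_nsmul_one_mem {L : AddSubgroup R} (hL : ∀ x, x ∈ L ↔ ¬ IsUnit x) (hp : p.Prime)
    (hone : (p ^ m) • (1 : R) = 0) {k : ℕ} (hk : k • (1 : R) ∈ L) : p ∣ k := by
  by_contra h
  refine (hL 1).1 ?_ isUnit_one
  have hcop : IsCoprime (k : ℤ) ((p ^ m : ℕ) : ℤ) :=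
    Nat.isCoprime_iff_coprime.2 (((hp.coprime_iff_not_dvd).2 h).symm.pow_right m)
  obtain ⟨u, v, huv⟩ := hcop
  have : (1 : R) = u • (k • (1 : R)) := by
    calc (1 : R) = (1 : ℤ) • (1 : R) := (one_zsmul _).symm
      _ = u • (k • (1 : R)) := by
        rw [← huv, add_zsmul, mul_zsmul, mul_zsmul, natCast_zsmul, natCast_zsmul, hone, zsmul_zero,
          add_zero]
  rw [this]
  exact zsmul_mem hk u

theorem exists_isGeneratingTriple {L : AddSubgroup R} (hL : ∀ x, x ∈ L ↔ ¬ IsUnit x)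
    (hp : p.Prime) (hp2 : Odd p) (hd : 1 ≤ d) (hdn : d ≤ n) (hnm : n ≤ m) {a b₀ c₀ : R}
    (T : IsStandardTriple (p ^ m) (p ^ n) (p ^ d) a b₀ c₀) :
    ∃ b c : R, IsGeneratingTriple (p ^ m) (p ^ n) (p ^ d) 1 b c ∧ ¬ IsUnit b := by
  have := Fact.mk hp
  have T' := T.toIsGeneratingTriple
  have exp := pow_nsmul_eq_zero hp2 hdn hnm T'
  obtain ⟨φ, hc, hφ⟩ := T.exists_hom_zmod (dvd_pow_self p (show m ≠ 0 by omega))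
    (dvd_pow_self p (show n ≠ 0 by omega))
  obtain ⟨k, l, t, h1⟩ := T.exists_normalForm (1 : R)
  -- By `of_isCoprime`, independence of `1` and `b` modulo `p` suffices.
  suffices ∃ b ∈ L, (p ^ n) • b = 0 ∧
      (φ 1).1 * (φ b).2 - (φ 1).2 * (φ b).1 ≠ 0 by
    obtain ⟨b, hbL, hb, hdet⟩ := this
    obtain ⟨k', l', t', h2⟩ := T.exists_normalForm b
    rw [h1, h2, hφ, hφ] at hdet
    have hD : ¬ (p : ℤ) ∣ k * l' - l * k' := by
      rw [← ZMod.intCast_zmod_eq_zero_iff_dvd]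
      push_cast
      exact hdet
    have hcop : ∀ i : ℕ, IsCoprime (k * l' - l * k') ((p ^ i : ℕ) : ℤ) := fun i => by
      rw [Nat.cast_pow]
      exact (((Nat.prime_iff_prime_int.1 hp).coprime_iff_not_dvd.2 hD).symm).pow_right
    have := T'.of_isCoprime (t := t) (t' := t') (hcop m) (hcop n) (hcop d) (exp _)
      (by rw [← h2]; exact hb)
    rw [← h1, ← h2] at this
    exact ⟨b, _, this, (hL b).1 hbL⟩
  rcases hnm.lt_or_eq with hlt | rfl
  · have hone : ∀ {i}, i < m → (p ^ i) • (1 : R) ≠ 0 := pow_nsmul_one_ne_zero hp hdn hnm T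
    refine ⟨b₀, ?_, T.order_b, ?_⟩
    · rw [hL]
      exact fun hu => hone hlt (nsmul_one_of_isUnit hu T.order_b)
    · have hb : φ b₀ = (0, 1) := by
        have := hφ 0 1 0
        simpa [normalForm] using this
      rw [hb, mul_one, mul_zero, sub_zero, h1, hφ]
      intro h0
      rw [ZMod.intCast_zmod_eq_zero_iff_dvd] at h0
      obtain ⟨j, rfl⟩ := h0
      refine hone (i := m - 1) (by omega) ?_
      rw [h1]
      -- If `p` divides the `a`-coordinate of `1`, then `p^(m-1)` already annihilates `1`, because
      -- `d ≤ n ≤ m - 1`.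
      refine T'.nsmul_eq_zero_of_odd hp2.pow ⟨j, ?_⟩ (pow_dvd_pow p (by omega))
        (pow_dvd_pow p (by omega)) t
      obtain ⟨i, rfl⟩ : ∃ i, m = i + 1 := ⟨m - 1, by omega⟩
      push_cast
      ring
  · obtain ⟨b, hbL, hb⟩ := exists_not_isUnit_frattini_ne_zero hL hp hp2 hd hdn le_rfl T hc hφ
    refine ⟨b, hbL, exp b, fun hdet => ?_⟩
    have hone : φ 1 ≠ 0 := frattini_one_ne_zero hL hp T' hc hφ
    -- A zero determinant makes `φ b` a multiple `i • φ 1`; then `i • 1` lies in `L`, which forces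
    -- `i = 0` and contradicts `φ b ≠ 0`.
    obtain ⟨i, hi⟩ : ∃ i : ZMod p, φ b = i • φ 1 := by
      by_cases h0 : (φ 1).1 = 0
      · have h0' : (φ 1).2 ≠ 0 := fun h => hone (Prod.ext h0 h)
        refine ⟨(φ b).2 / (φ 1).2, Prod.ext ?_ ?_⟩
        · rw [h0, zero_mul, zero_sub, neg_eq_zero] at hdet
          simp [h0, (mul_eq_zero.1 hdet).resolve_left h0']
        · simp [h0']
      · refine ⟨(φ b).1 / (φ 1).1, Prod.ext ?_ ?_⟩
        · simp [h0]
        · simp only [Prod.smul_snd, smul_eq_mul]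
          field_simp
          linear_combination hdet
    have hmem : b - i.val • (1 : R) ∈ L := by
      refine mem_nonunits_of_frattini_eq_zero hL hp hp2 hd hdn le_rfl T hc hφ ?_
      rw [map_sub, map_nsmul, hi, sub_eq_zero]
      ext <;> simp
    have hdvd := dvd_of_nsmul_one_mem hL hp (exp 1) (k := i.val) (by
      have := add_mem (neg_mem hmem) hbL
      simpa [sub_eq_add_neg] using this)
    have hi0 : i = 0 := by
      rw [← ZMod.natCast_zmod_val i, ZMod.natCast_eq_zero_iff]
      exact hdvd
    exact hb (by rw [hi, hi0, zero_smul])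

/-- `c` is central, so it commutes with `c b`; cancelling a unit `c` on the left would make `1` and
`b` commute, hence `c = 0`. -/
theorem not_isUnit_commutator [NeZero p]
    (T : IsGeneratingTriple (p ^ m) (p ^ n) (p ^ d) 1 b c) (hp : p.Prime) (hd : 1 ≤ d)
    (hR : Nat.card R = Nat.card (ZMod (p ^ m) × ZMod (p ^ n) × ZMod (p ^ d))) : ¬ IsUnit c := by
  rintro ⟨v, rfl⟩
  have H := T.isHeisenbergTriple
  have comm : (v : R) + v * b = v * b + v := by
    obtain ⟨k, l, t, e⟩ := T.exists_normalForm ((v : R) * b)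
    have := H.addCommute_normalForm k l t 1
    rw [one_zsmul] at this
    rw [e, this]
  have comm' : (1 : R) + b = b + 1 := by
    have := congrArg (fun y => (↑v⁻¹ : R) * y) comm
    simpa [left_distributive] using this
  have hc : (v : R) = 0 := by
    have := H.add_eq
    rwa [comm', left_eq_add] at this
  have e : normalForm 1 b (v : R) 0 0 1 = normalForm 1 b (v : R) 0 0 0 := by
    simp [normalForm, hc]
  have := (T.normalForm_inj hR e).2.2
  have := Int.modEq_zero_iff_dvd.1 this
  have := Int.natCast_dvd_natCast.1 (by simpa using this : ((p ^ d : ℕ) : ℤ) ∣ ((1 : ℕ) : ℤ))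
  exact absurd (Nat.dvd_one.1 this) (Nat.one_lt_pow (by omega) hp.one_lt).ne'

theorem isZeroSymmetric_iff (H : IsHeisenbergTriple 1 b c) (hspan : ∀ x : R, ∃ k l t : ℤ,
    x = normalForm 1 b c k l t) : IsZeroSymmetric R ↔ (0 : R) * b = 0 := by
  refine ⟨fun h => h b, fun h x => ?_⟩
  have hc : (0 : R) * c = 0 := by
    have := H.map_c H (mulLeft (0 : R)) (k := 0) (l := 0) (t := 0) (k' := 0) (l' := 0) (t' := 0)
      (by simp [mulLeft_apply, normalForm]) (by simp [mulLeft_apply, normalForm, h])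
    simpa [mulLeft_apply] using this
  obtain ⟨k, l, t, rfl⟩ := hspan x
  rw [← mulLeft_apply, map_normalForm, mulLeft_apply, mulLeft_apply, mulLeft_apply, mul_one, h, hc]
  simp [normalForm]

end Nearring

/-! ### Assembling the theorem -/

theorem corollary4 (p m n d : ℕ) (hp : p.Prime) (hp2 : 2 < p)
    (hd : 1 ≤ d) (hdn : d ≤ n) (hnm : n ≤ m)
    (R : Type*) [Nearring R] (hloc : Nearring.IsLocal R)
    (hG : Nonempty (Multiplicative R ≃* GroupG (p ^ m) (p ^ n) (p ^ d))) :
    -- generators `a = 1`, `b`, `c` exist, with `b` non-invertible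
    (∃ b c : R, IsGeneratingTriple (p ^ m) (p ^ n) (p ^ d) 1 b c ∧ ¬ IsUnit b) ∧
    ∀ b c : R, IsGeneratingTriple (p ^ m) (p ^ n) (p ^ d) 1 b c →
      -- for `n < m`, the generator `b` is always non-invertible
      (n < m → ¬ IsUnit b) ∧
      -- unique coordinates, and the uniquely defined maps `α`, `β`, `γ`
      (∀ x : R, ∃! u : ℕ × ℕ × ℕ, u.1 < p ^ m ∧ u.2.1 < p ^ n ∧ u.2.2 < p ^ d ∧
        x = u.1 • (1 : R) + u.2.1 • b + u.2.2 • c) ∧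
      (∃! f : R → ZMod (p ^ m) × ZMod (p ^ n) × ZMod (p ^ d), ∀ x : R,
        x * b = (f x).1.val • (1 : R) + (f x).2.1.val • b + (f x).2.2.val • c) ∧
      ∀ (α : R → ZMod (p ^ m)) (β : R → ZMod (p ^ n)) (γ : R → ZMod (p ^ d)),
        (∀ x : R, x * b = (α x).val • (1 : R) + (β x).val • b + (γ x).val • c) →
        -- (0)
        ((α 0 = 0 ∧ β 0 = 0 ∧ γ 0 = 0) ↔ Nearring.IsZeroSymmetric R) ∧
        -- (1)
        (¬ IsUnit b → ∀ x : R, (α x).val ≡ 0 [MOD p]) ∧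
        -- (2)
        (¬ IsUnit b → ∀ (x : R) (x₁ x₂ x₃ : ℕ),
          x = x₁ • (1 : R) + x₂ • b + x₃ • c →
          (β x).val ≡ 0 [MOD p] → x₁ ≡ 0 [MOD p]) ∧
        ∀ (x y : R) (x₁ x₂ x₃ y₁ y₂ y₃ : ℕ),
          x = x₁ • (1 : R) + x₂ • b + x₃ • c →
          y = y₁ • (1 : R) + y₂ • b + y₃ • c →
          -- the multiplication formula
          x * y = (x₁ * y₁ + y₂ * (α x).val) • (1 : R) + (x₂ * y₁ + y₂ * (β x).val) • b
            + (-(x₁ * x₂ * y₁.choose 2 : ℤ) - y₂.choose 2 * (α x).val * (β x).val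
                - x₂ * y₁ * y₂ * (α x).val + x₃ * y₁ + y₂ * (γ x).val
                + x₁ * y₃ * (β x).val - x₂ * y₃ * (α x).val : ℤ) • c ∧
          -- (3)
          ((α (x * y)).val : ℤ)
            ≡ x₁ * (α y).val + (α x).val * (β y).val [ZMOD ((p : ℤ) ^ m)] ∧
          -- (4)
          ((β (x * y)).val : ℤ)
            ≡ x₂ * (α y).val + (β x).val * (β y).val [ZMOD ((p : ℤ) ^ n)] ∧
          -- (5)
          ((γ (x * y)).val : ℤ)
            ≡ -(x₁ * x₂ * (α y).val.choose 2 : ℤ)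
                - (α x).val * (β x).val * (β y).val.choose 2
                - x₂ * (α x).val * (α y).val * (β y).val + x₃ * (α y).val
                + (γ x).val * (β y).val + x₁ * (β x).val * (γ y).val
                - x₂ * (α x).val * (γ y).val [ZMOD ((p : ℤ) ^ d)] := by
  have : NeZero p := ⟨hp.ne_zero⟩
  have hodd : Odd p := hp.odd_of_ne_two hp2.ne'
  obtain ⟨L, hLset⟩ := hloc
  have hL : ∀ x, x ∈ L ↔ ¬ IsUnit x := fun x => Set.ext_iff.1 hLset x
  obtain ⟨e⟩ := hG
  obtain ⟨a₀, b₀, c₀, T₀⟩ := exists_isStandardTriple e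
  have hR := T₀.card_eq (pow_dvd_pow p (hdn.trans hnm)) (pow_dvd_pow p hdn)
  have hfin : Finite R := Nat.finite_of_card_ne_zero (by rw [hR]; exact Nat.card_pos.ne')
  refine ⟨Nearring.exists_isGeneratingTriple hL hp hodd hd hdn hnm T₀, fun b c T => ?_⟩
  have H := T.isHeisenbergTriple
  have hcL : c ∈ L := (hL c).2 (Nearring.not_isUnit_commutator T hp hd hR)
  refine ⟨fun hlt hb => Nearring.pow_nsmul_one_ne_zero hp hdn hnm T₀ hlt
      (Nearring.nsmul_one_of_isUnit hb T.order_b),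
    T.existsUnique_coordinates hR, T.existsUnique_map hR _, fun α β γ hαβγ => ?_⟩
  simp only [← normalForm_natCast] at hαβγ ⊢
  have hb_eq : b = normalForm 1 b c (0 : ℕ) (1 : ℕ) (0 : ℕ) := by simp [normalForm]
  have alpha_dvd : ¬ IsUnit b → ∀ x : R, p ∣ (α x).val := by
    intro hb x
    refine Nearring.dvd_of_nsmul_one_mem hL hp T.order_a ?_
    -- In the finite monoid `R`, a right factor of a unit is a unit.
    have hxb : x * b ∈ L := (hL _).2 fun h => hb (isUnit_of_mul_isUnit_right h)
    rw [hαβγ, normalForm_natCast] at hxb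
    exact (L.add_mem_cancel_right (nsmul_mem ((hL b).2 hb) _)).1
      ((L.add_mem_cancel_right (nsmul_mem hcL _)).1 hxb)
  refine ⟨?_, fun hb x => Nat.modEq_zero_iff_dvd.2 (alpha_dvd hb x), ?_, ?_⟩
  · rw [Nearring.isZeroSymmetric_iff H T.exists_normalForm, hαβγ]
    constructor
    · rintro ⟨h1, h2, h3⟩
      simp [h1, h2, h3, normalForm]
    · intro h
      have h0 : normalForm 1 b c (α 0).val (β 0).val (γ 0).val
          = normalForm 1 b c 0 0 0 := by rw [h]; simp [normalForm]
      have := T.normalForm_inj hR h0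
      simp only [← ZMod.intCast_eq_intCast_iff] at this
      simpa using this
  · intro hb x x₁ x₂ x₃ hx hβ
    rw [Nat.modEq_zero_iff_dvd] at hβ ⊢
    by_cases hxL : x ∈ L
    · refine Nearring.dvd_of_nsmul_one_mem hL hp T.order_a ?_
      rw [hx, normalForm_natCast] at hxL
      exact (L.add_mem_cancel_right (nsmul_mem ((hL b).2 hb) _)).1
        ((L.add_mem_cancel_right (nsmul_mem hcL _)).1 hxL)
    · exfalso
      -- For a unit `x`, rule (4) applied to `x⁻¹x` writes `β(1) = 1` as a sum of terms divisible by
      -- `p`.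
      obtain ⟨v, hv⟩ : IsUnit x := by rwa [hL, not_not] at hxL
      obtain ⟨k, l, t, h'⟩ := T.exists_normalForm (↑v⁻¹ : R)
      have h2 := (T.normalForm_inj hR ((hαβγ (↑v⁻¹ * x)).symm.trans
        (Nearring.mul_mul_normalForm H h' (hαβγ _) (hαβγ x)))).2.1
      rw [← hv, Units.inv_mul, hv] at h2
      have h3 : ((β 1).val : ℤ) ≡ 1 [ZMOD ((p ^ n : ℕ) : ℤ)] := by
        have e1 := hαβγ 1
        rw [one_mul] at e1
        exact (T.normalForm_inj hR (e1.symm.trans hb_eq)).2.1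
      have h4 := (h3.symm.trans h2).of_dvd
        (Int.natCast_dvd_natCast.2 (dvd_pow_self p (show n ≠ 0 by omega)))
      have h5 : (p : ℤ) ∣ l * (α x).val + (β x).val * (β (↑v⁻¹ : R)).val :=
        dvd_add (Dvd.dvd.mul_left (Int.natCast_dvd_natCast.2 (alpha_dvd hb x)) _)
          (Dvd.dvd.mul_right (Int.natCast_dvd_natCast.2 hβ) _)
      have h6 := Int.modEq_zero_iff_dvd.1 (h4.trans (Int.modEq_zero_iff_dvd.2 h5))
      exact hp.one_lt.ne' (Nat.dvd_one.1 (Int.natCast_dvd_natCast.1 (by simpa using h6)))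
  · intro x y x₁ x₂ x₃ y₁ y₂ y₃ hx hy
    obtain ⟨h1, h2, h3⟩ := T.normalForm_inj hR ((hαβγ (x * y)).symm.trans
      (Nearring.mul_mul_normalForm H hx (hαβγ x) (hαβγ y)))
    refine ⟨?_, ?_, ?_, ?_⟩
    · rw [hy, Nearring.mul_normalForm H hx (hαβγ x), normalForm, ← natCast_zsmul, ← natCast_zsmul]
      push_cast
      rfl
    · rw [Nat.cast_pow] at h1
      convert h1 using 1
      ring
    · rw [Nat.cast_pow] at h2
      convert h2 using 1
      ring
    · rw [Nat.cast_pow] at h3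
      convert h3 using 1
      ring
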